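/- Let $K$ be a field, $S=K[X_i,Y_i \mid 1\le i\le n]$, and $[i,j]=X_iY_j-Y_iX_j$ for $i,j\in[n]=\{1,\dots,n\}$. Let $G$ be a simple graph on $[n]$ and let $I_G\subset S$ be the ideal generated by all $[i,j]$ with $\{i,j\}$ an edge of $G$. A walk of $G$ is a sequence $P=p_0p_1\ldots p_\ell$ of vertices in which consecutive vertices are adjacent and $p_0\le p_\ell$; it is a path if the $p_i$ are pairwise distinct. For walks $P=p_0\ldots p_\ell$ and $Q=q_0\ldots q_m$ write $P\le Q$ if there are indices $0=j_0<j_1<\dots<j_\ell=m$ with $q_{j_i}=p_i$ for all $i$. Let $J(P)=\{p_i\mid 0<i<\ell\}$ be the set of joints of $P$. A path $P$ of length $\ell\ge 1$ is called irreducible if it is minimal with respect to $\le$ among all walks of $G$ and no $p\in J(P)$ satisfies $p_0<p<p_\ell$. For an irreducible path $P=p_0\ldots p_\ell$ put $$g_P=M_P\cdot[p_0,p_\ell],\qquad M_P=\prod_{p\in J(P),\ p<p_0}Y_p\ \cdot\prod_{p\in J(P),\ p>p_\ell}X_p .$$ **Theorem 3.1.** The set $\mathcal G=\{g_P\mid P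 \text{ is an irreducible path of } G\}$ is the reduced Gröbner basis of $I_G$ with respect to the (graded) reverse lexicographic order on $S$ with $Y_1>Y_2>\dots>Y_n>X_1>X_2>\dots>X_n$. Here a finite set $\mathcal G\subset I_G$ is a Gröbner basis of $I_G$ if the leading terms of its elements generate the ideal generated by the leading terms of all elements of $I_G$; it is reduced if every $g\in\mathcal G$ has leading coefficient $1$ and no monomial occurring in $g$ lies in the ideal generated by the leading terms of the elements of $\mathcal G\setminus\{g\}$. -/

import Mathlib

open MvPolynomial

namespace BinomialEdge

/-! ### The (graded) reverse lexicographic order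

As everywhere in `MonomialOrder`, a smaller index stands for a larger variable. -/

/-- A copy of `σ →₀ ℕ` that carries the graded reverse lexicographic order. -/
def DegRevLex (σ : Type*) := σ →₀ ℕ

noncomputable instance (σ : Type*) : AddCommMonoid (DegRevLex σ) :=
  inferInstanceAs (AddCommMonoid (σ →₀ ℕ))

/-- The identity map. -/
noncomputable def toDegRevLex {σ : Type*} : (σ →₀ ℕ) ≃+ DegRevLex σ where
  toEquiv := Equiv.refl (σ →₀ ℕ)
  map_add' _ _ := rfl

/-- The key of an exponent vector: first the total degree, then the exponents read from the
smallest variable (the largest index) on, in the opposite order. -/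
noncomputable def degRevLexKey {σ : Type*} [LinearOrder σ] (a : DegRevLex σ) :
    ℕ ×ₗ (Colex (σ →₀ ℕ))ᵒᵈ :=
  toLex ((toDegRevLex.symm a).degree, OrderDual.toDual (toColex (toDegRevLex.symm a)))

theorem degRevLexKey_injective {σ : Type*} [LinearOrder σ] :
    Function.Injective (degRevLexKey (σ := σ)) := by
  intro a b h
  have h2 := congrArg (fun x => ofColex (OrderDual.ofDual (ofLex x).2)) h
  exact toDegRevLex.symm.injective h2

noncomputable instance (σ : Type*) [LinearOrder σ] : LinearOrder (DegRevLex σ) :=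
  LinearOrder.lift' degRevLexKey degRevLexKey_injective

/-- `a < b` iff `a` has smaller degree, or the degrees agree and, at the largest index (the
smallest variable) at which `a` and `b` differ, `a` has the larger exponent. -/
theorem toDegRevLex_lt_iff {σ : Type*} [LinearOrder σ] (a b : σ →₀ ℕ) :
    toDegRevLex a < toDegRevLex b ↔
      a.degree < b.degree ∨
        (a.degree = b.degree ∧ ∃ k, (∀ j, k < j → a j = b j) ∧ b k < a k) := by
  change degRevLexKey (toDegRevLex a) < degRevLexKey (toDegRevLex b) ↔ _
  unfold degRevLexKey
  rw [Prod.Lex.toLex_lt_toLex]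
  refine or_congr Iff.rfl (and_congr Iff.rfl ?_)
  change (∃ k, (∀ j, k < j → b j = a j) ∧ b k < a k) ↔ _
  simp only [eq_comm]

theorem toDegRevLex_add_lt {σ : Type*} [LinearOrder σ] (a b c : σ →₀ ℕ)
    (h : toDegRevLex a < toDegRevLex b) : toDegRevLex (a + c) < toDegRevLex (b + c) := by
  rw [toDegRevLex_lt_iff] at h ⊢
  simpa only [map_add, Finsupp.add_apply, add_lt_add_iff_right, add_left_inj] using h

instance (σ : Type*) [LinearOrder σ] : IsOrderedAddMonoid (DegRevLex σ) where
  add_le_add_left a b h c := by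
    rcases h.lt_or_eq with h | rfl
    · exact (toDegRevLex_add_lt (toDegRevLex.symm a) (toDegRevLex.symm b)
        (toDegRevLex.symm c) h).le
    · exact le_rfl

theorem toDegRevLex_monotone {σ : Type*} [LinearOrder σ] :
    Monotone (toDegRevLex (σ := σ)) := by
  intro a b h
  rcases h.lt_or_eq with h | rfl
  · refine le_of_lt ((toDegRevLex_lt_iff a b).2 (Or.inl ?_))
    obtain ⟨c, rfl⟩ := exists_add_of_le h.le
    rw [map_add]
    refine Nat.lt_add_of_pos_right (Nat.pos_of_ne_zero fun hc => ?_)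
    rw [Finsupp.degree_eq_zero_iff] at hc
    subst hc
    simp at h
  · exact le_rfl

instance (σ : Type*) [LinearOrder σ] [Finite σ] : WellFoundedLT (DegRevLex σ) where
  wf := by
    have hw : WellQuasiOrdered ((· ≤ ·) : (σ →₀ ℕ) → (σ →₀ ℕ) → Prop) := wellQuasiOrdered_le
    refine RelEmbedding.wellFounded_iff_isEmpty.2 ⟨fun f => ?_⟩
    obtain ⟨i, j, hij, hle⟩ := hw (fun k => toDegRevLex.symm (f k))
    exact absurd (toDegRevLex_monotone hle) (not_le_of_gt (f.map_rel_iff.2 hij))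

/-- The graded reverse lexicographic monomial order in finitely many variables. -/
noncomputable def degRevLex (σ : Type*) [LinearOrder σ] [Finite σ] : MonomialOrder σ where
  syn := DegRevLex σ
  toSyn := toDegRevLex
  toSyn_monotone := toDegRevLex_monotone

theorem degRevLex_lt_iff {σ : Type*} [LinearOrder σ] [Finite σ] (a b : σ →₀ ℕ) :
    (degRevLex σ).toSyn a < (degRevLex σ).toSyn b ↔
      a.degree < b.degree ∨
        (a.degree = b.degree ∧ ∃ k, (∀ j, k < j → a j = b j) ∧ b k < a k) :=
  toDegRevLex_lt_iff a b

/-! ### Reduced Gröbner bases -/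

/-- `B` is a Gröbner basis of `I`: a finite subset of `I` whose leading terms generate the
ideal generated by the leading terms of all elements of `I`. -/
def IsGroebnerBasis {σ K : Type*} [Field K] (m : MonomialOrder σ)
    (I : Ideal (MvPolynomial σ K)) (B : Set (MvPolynomial σ K)) : Prop :=
  B.Finite ∧ B ⊆ (I : Set (MvPolynomial σ K)) ∧
    Ideal.span (m.leadingTerm '' B) = Ideal.span (m.leadingTerm '' (I : Set (MvPolynomial σ K)))

/-- A Gröbner basis is reduced if its elements have leading coefficient `1` and no monomial
of an element lies in the ideal generated by the leading terms of the other elements. -/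
def IsReducedGroebnerBasis {σ K : Type*} [Field K] (m : MonomialOrder σ)
    (I : Ideal (MvPolynomial σ K)) (B : Set (MvPolynomial σ K)) : Prop :=
  IsGroebnerBasis m I B ∧
    ∀ g ∈ B, m.leadingCoeff g = 1 ∧
      ∀ d ∈ g.support, monomial d (1 : K) ∉ Ideal.span (m.leadingTerm '' (B \ {g}))

/-! ### The ideal of a graph -/

/-- The indices of the variables, in the order `Y_1, …, Y_n, X_1, …, X_n`
(from the largest variable to the smallest). -/
abbrev Var (n : ℕ) := Fin n ⊕ₗ Fin n

/-- The variable `X_i`. -/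
noncomputable def varX (K : Type*) [Field K] {n : ℕ} (i : Fin n) : MvPolynomial (Var n) K :=
  X (Sum.inrₗ i)

/-- The variable `Y_i`. -/
noncomputable def varY (K : Type*) [Field K] {n : ℕ} (i : Fin n) : MvPolynomial (Var n) K :=
  X (Sum.inlₗ i)

/-- The minor `[i, j] = X_i Y_j - Y_i X_j` of the generic `2 × n` matrix. -/
noncomputable def minor (K : Type*) [Field K] {n : ℕ} (i j : Fin n) : MvPolynomial (Var n) K :=
  varX K i * varY K j - varY K i * varX K j

/-- The ideal `I_G` generated by the minors `[i, j]` with `{i, j}` an edge of `G`. -/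
noncomputable def edgeIdeal (K : Type*) [Field K] {n : ℕ} (G : SimpleGraph (Fin n)) :
    Ideal (MvPolynomial (Var n) K) :=
  Ideal.span {f | ∃ i j, G.Adj i j ∧ f = minor K i j}

/-! ### Irreducible paths -/

/-- The order on walks: `P ≤ Q` if `P = p_0 … p_ℓ` is a subsequence of `Q = q_0 … q_m`, via
indices `0 = j_0 < j_1 < … < j_ℓ = m`. Comparable walks have the same ends. -/
def WalkLE {n : ℕ} {G : SimpleGraph (Fin n)} {u v : Fin n} (P Q : G.Walk u v) : Prop :=
  ∃ j : ℕ → ℕ, j 0 = 0 ∧ j P.length = Q.length ∧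
    (∀ i < P.length, j i < j (i + 1)) ∧ ∀ i ≤ P.length, Q.getVert (j i) = P.getVert i

/-- The joints of `P = p_0 … p_ℓ`: the vertices `p_i` with `0 < i < ℓ`. -/
def joints {n : ℕ} {G : SimpleGraph (Fin n)} {u v : Fin n} (P : G.Walk u v) :
    Finset (Fin n) :=
  (Finset.Ioo 0 P.length).image P.getVert

/-- `P = p_0 … p_ℓ` is an irreducible path: it is a path with `p_0 < p_ℓ` (so `ℓ ≥ 1`), minimal
in the order on walks, and no joint `p` satisfies `p_0 < p < p_ℓ`. -/
def IsIrreduciblePath {n : ℕ} {G : SimpleGraph (Fin n)} {u v : Fin n} (P : G.Walk u v) : Prop :=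
  u < v ∧ P.IsPath ∧ (∀ Q : G.Walk u v, WalkLE Q P → Q = P) ∧
    ∀ p ∈ joints P, ¬(u < p ∧ p < v)

/-- The monomial `M_P`. -/
noncomputable def pathMonomial (K : Type*) [Field K] {n : ℕ} {G : SimpleGraph (Fin n)}
    {u v : Fin n} (P : G.Walk u v) : MvPolynomial (Var n) K :=
  (∏ p ∈ joints P with p < u, varY K p) * ∏ p ∈ joints P with v < p, varX K p

/-- The polynomial `g_P = M_P · [p_0, p_ℓ]`. -/
noncomputable def pathPoly (K : Type*) [Field K] {n : ℕ} {G : SimpleGraph (Fin n)}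
    {u v : Fin n} (P : G.Walk u v) : MvPolynomial (Var n) K :=
  pathMonomial K P * minor K u v

end BinomialEdge

/-!
The ideal `I_G` is generated by differences of monomials, and the exchange of `X_i Y_j` for
`Y_i X_j` along an edge `{i, j}` preserves two invariants of a monomial (`monomialClass_exchange`):
the multidegree, and the number of `X`-factors on each connected component of the subgraph of `G`
induced on the vertices of the monomial. So the coefficients of an element of `I_G` sum to zero over
each class of monomials with the same invariants (`classSum_eq_zero`), and its leading monomial is
not the smallest monomial of its class.

In the reverse lexicographic order, a monomial that is not the smallest of its class contains
`X_u` and `Y_v` for some `u < v` in the same component (`exists_linked_of_lt`). A shortest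
walk inside the vertices of the monomial that joins such a pair is an irreducible path `P`, and
minimality forces `M_P X_u Y_v`, the leading monomial of `g_P`, to divide the given monomial
(`exists_isIrreduciblePath`, `leadExponent_le`). Together with `g_P ∈ I_G`, which follows from the
Plücker relations (`prod_mul_minor_mem`), this shows that the `g_P` form a Gröbner basis; no
S-polynomials are needed.

For reducedness, suppose that the leading monomial of `g_Q` divides a monomial of `g_P`. Then `P`
and `Q` have the same ends and the joints of `Q` are joints of `P`; as `P` has no chords, `Q`
passes through all of them, so `g_P = g_Q` (`pathPoly_eq_of_leadExponent_le`).
-/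

open MvPolynomial

namespace BinomialEdge

variable {n : ℕ} {G : SimpleGraph (Fin n)} {u v : Fin n}

/-! ### Irreducible paths -/

theorem mem_joints_iff {P : G.Walk u v} {p : Fin n} :
    p ∈ joints P ↔ ∃ i, 0 < i ∧ i < P.length ∧ P.getVert i = p := by
  simp [joints, and_assoc]

theorem ne_ends_of_mem_joints {P : G.Walk u v} (hP : P.IsPath) {p : Fin n} (hp : p ∈ joints P) :
    p ≠ u ∧ p ≠ v := by
  obtain ⟨i, h0, hi, rfl⟩ := mem_joints_iff.1 hp
  constructor
  · intro h
    have := hP.getVert_injOn (x₁ := i) (x₂ := 0) hi.le (Nat.zero_le _) (by simpa using h)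
    omega
  · intro h
    have := hP.getVert_injOn (x₁ := i) (x₂ := P.length) hi.le (by simp) (by simpa using h)
    omega

theorem joints_cons {w : Fin n} (h : G.Adj u w) (P : G.Walk w v) (hP : 0 < P.length) :
    joints (P.cons h) = insert w (joints P) := by
  ext p
  rw [Finset.mem_insert, mem_joints_iff, mem_joints_iff]
  constructor
  · rintro ⟨_ | _ | i, h0, hi, rfl⟩
    · omega
    · simp
    · exact Or.inr ⟨i + 1, by omega, by simpa using hi, rfl⟩
  · rintro (rfl | ⟨i, h0, hi, rfl⟩)
    · exact ⟨1, by omega, by simpa using hP, by simp⟩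
    · exact ⟨i + 1, by omega, by simpa using hi, rfl⟩

theorem getVert_eq_or_mem_joints (P : G.Walk u v) (i : ℕ) :
    P.getVert i = u ∨ P.getVert i = v ∨ P.getVert i ∈ joints P := by
  rcases Nat.eq_zero_or_pos i with rfl | h0
  · simp
  rcases Nat.lt_or_ge i P.length with hi | hi
  · exact Or.inr (Or.inr (mem_joints_iff.2 ⟨i, h0, hi, rfl⟩))
  · exact Or.inr (Or.inl (P.getVert_of_length_le hi))

/-- A subsequence of a walk is no longer than the walk, it runs through vertices of the walk only,
and it is the whole walk once it has the same length. -/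
theorem WalkLE.shorter {P Q : G.Walk u v} (h : WalkLE P Q) :
    P.length ≤ Q.length ∧ (∀ i, ∃ j, P.getVert i = Q.getVert j) ∧
      (P.length = Q.length → P = Q) := by
  obtain ⟨j, h0, hl, hlt, hv⟩ := h
  have h1 : ∀ i, i ≤ P.length → i ≤ j i := by
    intro i
    induction i with
    | zero => simp
    | succ i ih => intro hi; have := ih (by omega); have := hlt i (by omega); omega
  have h2 : ∀ k, k ≤ P.length → j (P.length - k) + k ≤ Q.length := by
    intro k
    induction k with
    | zero => simp [hl]
    | succ k ih =>
      intro hk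
      have := ih (by omega)
      have h3 := hlt (P.length - (k + 1)) (by omega)
      rw [show P.length - (k + 1) + 1 = P.length - k by omega] at h3
      omega
  refine ⟨(h1 _ le_rfl).trans hl.le, fun i => ?_, fun he => ?_⟩
  · rcases le_total i P.length with hi | hi
    · exact ⟨j i, (hv i hi).symm⟩
    · exact ⟨Q.length, by rw [P.getVert_of_length_le hi, Q.getVert_length]⟩
  · refine SimpleGraph.Walk.ext_getVert_le_length he fun i hi => ?_
    have h3 := h2 (P.length - i) (by omega)
    rw [show P.length - (P.length - i) = i by omega] at h3
    have h4 := h1 i hi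
    rw [← hv i hi, show j i = i by omega]

/-- An irreducible path has no chords. -/
theorem IsIrreduciblePath.eq_succ_of_adj {P : G.Walk u v} (hP : IsIrreduciblePath P) {i k : ℕ}
    (hik : i < k) (hk : k ≤ P.length) (h : G.Adj (P.getVert i) (P.getVert k)) : k = i + 1 := by
  -- The chord gives a walk that leaves out the vertices strictly between the indices `i` and `k`.
  let Q : G.Walk u v := (P.take i).append ((P.drop k).cons h)
  have hi : (P.take i).length = i := by rw [SimpleGraph.Walk.take_length]; omega
  have hlen : Q.length = i + 1 + (P.length - k) := by
    simp only [Q, SimpleGraph.Walk.length_append, SimpleGraph.Walk.length_cons,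
      SimpleGraph.Walk.drop_length, hi]
    omega
  have hQ : WalkLE Q P := by
    refine ⟨fun t => if t ≤ i then t else t + k - i - 1, by simp, ?_, ?_, ?_⟩
    · rw [hlen]
      dsimp only
      split_ifs <;> omega
    · intro t _
      dsimp only
      split_ifs <;> omega
    · intro t _
      simp only [Q, SimpleGraph.Walk.getVert_append', hi]
      split_ifs with ht
      · rw [SimpleGraph.Walk.take_getVert, min_eq_right ht]
      · rw [SimpleGraph.Walk.getVert_cons _ _ (by omega), SimpleGraph.Walk.drop_getVert]
        congr 1
        omega
  have := congrArg SimpleGraph.Walk.length (hP.2.2.1 Q hQ)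
  omega

/-- A walk between the ends of an irreducible path that only uses vertices of the path uses all of
them: the path has no chords, so such a walk cannot jump over a joint. -/
theorem IsIrreduciblePath.joints_subset {P : G.Walk u v} (hP : IsIrreduciblePath P)
    (Q : G.Walk u v) (hQ : joints Q ⊆ joints P) : joints P ⊆ joints Q := by
  intro p hp
  obtain ⟨t, h0, ht, rfl⟩ := mem_joints_iff.1 hp
  by_contra hn
  have hends := ne_ends_of_mem_joints hP.2.1 hp
  have hmiss : ∀ m, Q.getVert m ≠ P.getVert t := by
    intro m hm
    rcases getVert_eq_or_mem_joints Q m with h | h | h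
    · exact hends.1 (hm.symm.trans h)
    · exact hends.2 (hm.symm.trans h)
    · exact hn (hm ▸ h)
  have honP : ∀ m, ∃ k ≤ P.length, Q.getVert m = P.getVert k := by
    intro m
    rcases getVert_eq_or_mem_joints Q m with h | h | h
    · exact ⟨0, by omega, by simpa using h⟩
    · exact ⟨P.length, le_rfl, by simpa using h⟩
    · obtain ⟨k, -, hk, he⟩ := mem_joints_iff.1 (hQ h)
      exact ⟨k, hk.le, he.symm⟩
  have hbefore : ∀ m, ∃ i < t, Q.getVert m = P.getVert i := by
    intro m
    induction m with
    | zero => exact ⟨0, h0, by simp⟩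
    | succ m ih =>
      obtain ⟨i, hi, he⟩ := ih
      rcases Nat.lt_or_ge m Q.length with hm | hm
      · obtain ⟨k, hk, he'⟩ := honP (m + 1)
        have hadj := Q.adj_getVert_succ hm
        rw [he, he'] at hadj
        have hkt : k ≠ t := by rintro rfl; exact hmiss _ he'
        refine ⟨k, ?_, he'⟩
        by_contra hlt
        have := hP.eq_succ_of_adj (by omega) hk hadj
        omega
      · exact ⟨i, hi, by
          rw [← he, Q.getVert_of_length_le hm, Q.getVert_of_length_le (by omega)]⟩
  obtain ⟨i, hi, he⟩ := hbefore Q.length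
  have := hP.2.1.getVert_injOn (x₁ := P.length) (x₂ := i) (by simp) (by simp; omega)
    (by simpa using he)
  omega

/-- `u` and `v` lie in the same connected component of the subgraph of `G` induced on `S`. -/
def Linked (G : SimpleGraph (Fin n)) (S : Set (Fin n)) (u v : Fin n) : Prop :=
  ∃ W : G.Walk u v, ∀ i, W.getVert i ∈ S

theorem Linked.trans {S : Set (Fin n)} {w : Fin n} (h : Linked G S u v) (h' : Linked G S v w) :
    Linked G S u w := by
  obtain ⟨W, hW⟩ := h
  obtain ⟨W', hW'⟩ := h'
  refine ⟨W.append W', fun i => ?_⟩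
  rw [SimpleGraph.Walk.getVert_append]
  split_ifs
  exacts [hW _, hW' _]

theorem Linked.symm {S : Set (Fin n)} (h : Linked G S u v) : Linked G S v u := by
  obtain ⟨W, hW⟩ := h
  refine ⟨W.reverse, fun i => ?_⟩
  rw [SimpleGraph.Walk.getVert_reverse]
  exact hW _

theorem Linked.refl {S : Set (Fin n)} (h : u ∈ S) : Linked G S u u :=
  ⟨.nil, fun i => by simpa using h⟩

theorem Linked.of_adj {S : Set (Fin n)} (h : G.Adj u v) (hu : u ∈ S) (hv : v ∈ S) :
    Linked G S u v :=
  ⟨h.toWalk, fun i => by rcases i with _ | i <;> simp [hu, hv]⟩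

/-- A shortest walk inside `A ∪ B` from a vertex of `A` up to a larger vertex of `B` is an
irreducible path; its joints below the ends are not in `A` and those above are not in `B`, since
they would be the ends of a shorter such walk. -/
theorem exists_isIrreduciblePath {A B : Set (Fin n)}
    (h : ∃ u ∈ A, ∃ v ∈ B, u < v ∧ Linked G (A ∪ B) u v) :
    ∃ u ∈ A, ∃ v ∈ B, ∃ P : G.Walk u v, IsIrreduciblePath P ∧
      ∀ p ∈ joints P, (p < u → p ∈ B) ∧ (v < p → p ∈ A) := by
  classical
  have hex : ∃ l, ∃ u ∈ A, ∃ v ∈ B, u < v ∧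
      ∃ W : G.Walk u v, (∀ i, W.getVert i ∈ A ∪ B) ∧ W.length = l := by
    obtain ⟨u, hu, v, hv, huv, W, hW⟩ := h
    exact ⟨_, u, hu, v, hv, huv, W, hW, rfl⟩
  obtain ⟨u, hu, v, hv, huv, W, hW, hlen⟩ := Nat.find_spec hex
  have hmin : ∀ {u' v' : Fin n}, u' ∈ A → v' ∈ B → u' < v' → ∀ W' : G.Walk u' v',
      (∀ i, W'.getVert i ∈ A ∪ B) → W.length ≤ W'.length := by
    intro u' v' hu' hv' huv' W' hW'
    rw [hlen]
    exact Nat.find_min' hex ⟨u', hu', v', hv', huv', W', hW', rfl⟩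
  have hP : ∀ i, W.bypass.getVert i ∈ A ∪ B := by
    intro i
    have := W.support_bypass_subset_support (W.bypass.getVert_mem_support i)
    obtain ⟨j, hj, -⟩ := SimpleGraph.Walk.mem_support_iff_exists_getVert.1 this
    exact hj ▸ hW j
  have hPl : W.bypass.length ≤ W.length := W.length_bypass_le_length
  have hpath := W.bypass_isPath
  generalize W.bypass = P at hP hPl hpath
  have htake : ∀ {p}, p ∈ joints P → p ∈ B → ¬ u < p := by
    rintro p hp hpB hup
    obtain ⟨i, h0, hi, rfl⟩ := mem_joints_iff.1 hp
    have := hmin hu hpB hup (P.take i) fun j => by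
      rw [SimpleGraph.Walk.take_getVert]
      exact hP _
    rw [SimpleGraph.Walk.take_length] at this
    omega
  have hdrop : ∀ {p}, p ∈ joints P → p ∈ A → ¬ p < v := by
    rintro p hp hpA hpv
    obtain ⟨i, h0, hi, rfl⟩ := mem_joints_iff.1 hp
    have := hmin hpA hv hpv (P.drop i) fun j => by
      rw [SimpleGraph.Walk.drop_getVert]
      exact hP _
    rw [SimpleGraph.Walk.drop_length] at this
    omega
  have hAB : ∀ {p}, p ∈ joints P → p ∈ A ∨ p ∈ B := by
    intro p hp
    obtain ⟨i, -, -, rfl⟩ := mem_joints_iff.1 hp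
    exact hP i
  refine ⟨u, hu, v, hv, P, ⟨huv, hpath, fun Q hQ => ?_, fun p hp hpuv => ?_⟩, fun p hp =>
    ⟨fun hpu => ?_, fun hvp => ?_⟩⟩
  · obtain ⟨hl, hvert, heq⟩ := hQ.shorter
    refine heq (le_antisymm hl (hPl.trans (hmin hu hv huv Q fun i => ?_)))
    obtain ⟨j, hj⟩ := hvert i
    exact hj ▸ hP j
  · rcases hAB hp with h | h
    exacts [hdrop hp h hpuv.2, htake hp h hpuv.1]
  · exact (hAB hp).resolve_left fun h => hdrop hp h (hpu.trans huv)
  · exact (hAB hp).resolve_right fun h => htake hp h (huv.trans hvp)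

/-! ### The classes of monomials modulo `I_G` -/

/-- The vertices `i` such that `X_i` divides the monomial with exponent vector `d`. -/
def xVerts (d : Var n →₀ ℕ) : Set (Fin n) := {i | d (Sum.inrₗ i) ≠ 0}

/-- The vertices `i` such that `Y_i` divides the monomial with exponent vector `d`. -/
def yVerts (d : Var n →₀ ℕ) : Set (Fin n) := {i | d (Sum.inlₗ i) ≠ 0}

/-- The multidegree of a monomial, where `X_i` and `Y_i` both have degree `e_i`. -/
def multidegree (d : Var n →₀ ℕ) (i : Fin n) : ℕ := d (Sum.inrₗ i) + d (Sum.inlₗ i)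

/-- The vertices `i` such that `X_i` or `Y_i` divides the monomial. -/
abbrev verts (d : Var n →₀ ℕ) : Set (Fin n) := xVerts d ∪ yVerts d

open Classical in
/-- The number of `X`-factors of a monomial, counted with multiplicity, at the vertices in the
component of `i` in the subgraph of `G` induced on the vertices of the monomial. -/
noncomputable def xCount (G : SimpleGraph (Fin n)) (d : Var n →₀ ℕ) (i : Fin n) : ℕ :=
  ∑ j with Linked G (verts d) i j, d (Sum.inrₗ j)

/-- The class of a monomial: its multidegree and the number of its `X`-factors on each
component. -/
noncomputable def monomialClass (G : SimpleGraph (Fin n)) (d : Var n →₀ ℕ) :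
    (Fin n → ℕ) × (Fin n → ℕ) :=
  (multidegree d, xCount G d)

theorem mem_verts_iff {d : Var n →₀ ℕ} {i : Fin n} : i ∈ verts d ↔ multidegree d i ≠ 0 := by
  simp only [verts, xVerts, yVerts, multidegree, Set.mem_union, Set.mem_ofPred_eq]
  omega

theorem verts_eq_of_multidegree_eq {d e : Var n →₀ ℕ} (h : multidegree d = multidegree e) :
    verts d = verts e := by
  ext i
  rw [mem_verts_iff, mem_verts_iff, h]

theorem degree_eq_sum_multidegree (d : Var n →₀ ℕ) : d.degree = ∑ i, multidegree d i := by
  rw [Finsupp.degree_eq_sum, ← (toLex : Fin n ⊕ Fin n ≃ Var n).sum_comp, Fintype.sum_sum_type,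
    add_comm, ← Finset.sum_add_distrib]
  rfl

/-- If a monomial is not the smallest one of its class, then it contains `X_u` and `Y_v` for some
`u < v` in the same component: otherwise, on each component, all its `Y`-factors are at smaller
vertices than its `X`-factors, up to one common vertex, which makes the last `X`-exponents as
large as possible. -/
theorem exists_linked_of_lt {d e : Var n →₀ ℕ}
    (hlt : (degRevLex (Var n)).toSyn e < (degRevLex (Var n)).toSyn d)
    (hcls : monomialClass G e = monomialClass G d) :
    ∃ u ∈ xVerts d, ∃ v ∈ yVerts d, u < v ∧ Linked G (verts d) u v := by
  classical
  have hmul : multidegree e = multidegree d := congrArg Prod.fst hcls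
  have hx : xCount G e = xCount G d := congrArg Prod.snd hcls
  have hV := verts_eq_of_multidegree_eq hmul
  have hsum : ∀ i, e (Sum.inrₗ i) + e (Sum.inlₗ i) = d (Sum.inrₗ i) + d (Sum.inlₗ i) :=
    fun i => congrFun hmul i
  rw [degRevLex_lt_iff] at hlt
  rcases hlt with hlt | ⟨-, k, habove, hk⟩
  · rw [degree_eq_sum_multidegree, degree_eq_sum_multidegree, hmul] at hlt
    exact absurd hlt (lt_irrefl _)
  obtain ⟨k, rfl⟩ := toLex.surjective k
  rcases k with k | k
  · -- All `X`-exponents agree, hence so do the `Y`-exponents.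
    have := habove (Sum.inrₗ k) (Sum.Lex.inl_lt_inr _ _)
    have := hsum k
    change d (Sum.inlₗ k) < e (Sum.inlₗ k) at hk
    omega
  change d (Sum.inrₗ k) < e (Sum.inrₗ k) at hk
  have hkd : k ∈ yVerts d := by
    have := hsum k
    simp only [yVerts, Set.mem_ofPred_eq]
    omega
  have hkk : Linked G (verts d) k k := Linked.refl (Or.inr hkd)
  -- The two monomials have equally many `X`-factors on the component of `k`.
  obtain ⟨j, hj, hje⟩ : ∃ j, Linked G (verts d) k j ∧ e (Sum.inrₗ j) < d (Sum.inrₗ j) := by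
    by_contra! hno
    have hc := congrFun hx k
    simp only [xCount, hV] at hc
    refine absurd hc.symm (ne_of_lt (Finset.sum_lt_sum (fun j hj => ?_) ⟨k, ?_, hk⟩))
    · exact hno j (Finset.mem_filter.1 hj).2
    · simpa using hkk
  refine ⟨j, ?_, k, hkd, ?_, hj.symm⟩
  · simp only [xVerts, Set.mem_ofPred_eq]
    omega
  · by_contra hkj
    rcases (not_lt.1 hkj).lt_or_eq with h | rfl
    · have := habove (Sum.inrₗ j) (Sum.Lex.inr_lt_inr_iff.2 h)
      omega
    · omega

/-- Exchanging the factors `X_i Y_j` for `Y_i X_j` along an edge does not change the class. -/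
theorem monomialClass_exchange (d : Var n →₀ ℕ) {i j : Fin n} (h : G.Adj i j) :
    monomialClass G (d + (Finsupp.single (Sum.inrₗ i) 1 + Finsupp.single (Sum.inlₗ j) 1)) =
      monomialClass G (d + (Finsupp.single (Sum.inlₗ i) 1 + Finsupp.single (Sum.inrₗ j) 1)) := by
  classical
  set a := d + (Finsupp.single (Sum.inrₗ i) 1 + Finsupp.single (Sum.inlₗ j) 1) with ha
  set b := d + (Finsupp.single (Sum.inlₗ i) 1 + Finsupp.single (Sum.inrₗ j) 1) with hb
  have hax : ∀ k, a (Sum.inrₗ k) = d (Sum.inrₗ k) + if i = k then 1 else 0 := by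
    intro k
    simp [ha, Finsupp.single_apply]
  have hay : ∀ k, a (Sum.inlₗ k) = d (Sum.inlₗ k) + if j = k then 1 else 0 := by
    intro k
    simp [ha, Finsupp.single_apply]
  have hbx : ∀ k, b (Sum.inrₗ k) = d (Sum.inrₗ k) + if j = k then 1 else 0 := by
    intro k
    simp [hb, Finsupp.single_apply]
  have hby : ∀ k, b (Sum.inlₗ k) = d (Sum.inlₗ k) + if i = k then 1 else 0 := by
    intro k
    simp [hb, Finsupp.single_apply]
  have hmul : multidegree a = multidegree b := by
    funext k
    simp only [multidegree, hax, hay, hbx, hby]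
    omega
  have hV := verts_eq_of_multidegree_eq hmul
  refine Prod.ext hmul (funext fun k => ?_)
  have hi : i ∈ verts b := Or.inr (by simp [yVerts, hby])
  have hj : j ∈ verts b := Or.inl (by simp [xVerts, hbx])
  have hij : Linked G (verts b) k i ↔ Linked G (verts b) k j :=
    ⟨fun hl => hl.trans (.of_adj h hi hj), fun hl => hl.trans (.of_adj h.symm hj hi)⟩
  simp only [monomialClass, xCount, hV, hax, hbx, Finset.sum_add_distrib]
  simp [hij]

/-! ### Leading monomials of the elements of `I_G` -/

variable {K : Type*} [Field K]

open Classical in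
/-- The sum of the coefficients of a polynomial at the monomials of the class `c`. -/
noncomputable def classSum (K : Type*) [Field K] (G : SimpleGraph (Fin n))
    (c : (Fin n → ℕ) × (Fin n → ℕ)) : MvPolynomial (Var n) K →ₗ[K] K :=
  (basisMonomials (Var n) K).constr K fun d => if monomialClass G d = c then 1 else 0

open Classical in
theorem classSum_monomial (c : (Fin n → ℕ) × (Fin n → ℕ)) (d : Var n →₀ ℕ) (r : K) :
    classSum K G c (monomial d r) = if monomialClass G d = c then r else 0 := by
  have h : monomial d r = r • (basisMonomials (Var n) K) d := by
    simp [coe_basisMonomials, smul_monomial]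
  rw [h, map_smul, classSum, Module.Basis.constr_basis]
  simp

open Classical in
theorem classSum_apply (c : (Fin n → ℕ) × (Fin n → ℕ)) (f : MvPolynomial (Var n) K) :
    classSum K G c f = ∑ d ∈ f.support with monomialClass G d = c, coeff d f := by
  conv_lhs => rw [f.as_sum, map_sum]
  simp only [classSum_monomial, Finset.sum_filter]

theorem minor_eq_monomial (i j : Fin n) :
    minor K i j = monomial (Finsupp.single (Sum.inrₗ i) 1 + Finsupp.single (Sum.inlₗ j) 1) 1 -
      monomial (Finsupp.single (Sum.inlₗ i) 1 + Finsupp.single (Sum.inrₗ j) 1) 1 := by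
  simp [minor, varX, varY, X, monomial_mul]

/-- The generators of `I_G`, and hence all its elements, have coefficient sum zero on each
class of monomials. -/
theorem classSum_eq_zero (c : (Fin n → ℕ) × (Fin n → ℕ)) {f : MvPolynomial (Var n) K}
    (hf : f ∈ edgeIdeal K G) : classSum K G c f = 0 := by
  classical
  suffices ∀ p : MvPolynomial (Var n) K, classSum K G c (p * f) = 0 by simpa using this 1
  induction hf using Submodule.span_induction with
  | mem f hf =>
    obtain ⟨i, j, hij, rfl⟩ := hf
    intro p
    induction p using MvPolynomial.induction_on' with
    | monomial d r =>
      rw [minor_eq_monomial, mul_sub, monomial_mul, monomial_mul, map_sub, classSum_monomial,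
        classSum_monomial, monomialClass_exchange d hij, sub_self]
    | add p q hp hq => rw [add_mul, map_add, hp, hq, add_zero]
  | zero => simp
  | add f g _ _ hf hg => intro p; rw [mul_add, map_add, hf, hg, add_zero]
  | smul a f _ hf => intro p; rw [smul_eq_mul, ← mul_assoc, hf]

theorem exists_lt_monomialClass_eq {f : MvPolynomial (Var n) K} (hf : f ∈ edgeIdeal K G)
    (h0 : f ≠ 0) :
    ∃ e, (degRevLex (Var n)).toSyn e < (degRevLex (Var n)).toSyn ((degRevLex (Var n)).degree f) ∧
      monomialClass G e = monomialClass G ((degRevLex (Var n)).degree f) := by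
  classical
  set d := (degRevLex (Var n)).degree f
  have hd : d ∈ f.support := (MonomialOrder.degree_mem_support_iff f).2 h0
  have hs := classSum_eq_zero (monomialClass G d) hf
  rw [classSum_apply] at hs
  by_contra! hno
  rw [Finset.sum_eq_single_of_mem d (by simpa using hd)] at hs
  · exact mem_support_iff.1 hd hs
  · intro e he hne
    rw [Finset.mem_filter] at he
    refine absurd he.2 (hno e (lt_of_le_of_ne (MonomialOrder.le_degree he.1) fun h => hne ?_))
    exact (degRevLex (Var n)).toSyn.injective h

/-! ### The polynomials `g_P` -/

/-- The exponent vector of `M_P`. -/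
noncomputable def pathExponent (P : G.Walk u v) : Var n →₀ ℕ :=
  (∑ p ∈ joints P with p < u, Finsupp.single (Sum.inlₗ p) 1) +
    ∑ p ∈ joints P with v < p, Finsupp.single (Sum.inrₗ p) 1

/-- The exponent vector of `M_P X_u Y_v`. -/
noncomputable def leadExponent (P : G.Walk u v) : Var n →₀ ℕ :=
  pathExponent P + (Finsupp.single (Sum.inrₗ u) 1 + Finsupp.single (Sum.inlₗ v) 1)

/-- The exponent vector of `M_P Y_u X_v`. -/
noncomputable def tailExponent (P : G.Walk u v) : Var n →₀ ℕ :=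
  pathExponent P + (Finsupp.single (Sum.inlₗ u) 1 + Finsupp.single (Sum.inrₗ v) 1)

theorem pathExponent_inr (P : G.Walk u v) (i : Fin n) :
    pathExponent P (Sum.inrₗ i) = if i ∈ joints P ∧ v < i then 1 else 0 := by
  simp [pathExponent, Finsupp.single_apply]

theorem pathExponent_inl (P : G.Walk u v) (i : Fin n) :
    pathExponent P (Sum.inlₗ i) = if i ∈ joints P ∧ i < u then 1 else 0 := by
  simp [pathExponent, Finsupp.single_apply]

theorem pathPoly_eq_monomial (P : G.Walk u v) :
    pathPoly K P = monomial (leadExponent P) 1 - monomial (tailExponent P) 1 := by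
  have h : pathMonomial K P = monomial (pathExponent P) 1 := by
    simp only [pathMonomial, pathExponent, varX, varY, X, ← monomial_sum_one]
    rw [monomial_mul, one_mul]
  rw [pathPoly, h, minor_eq_monomial, mul_sub, monomial_mul, monomial_mul, one_mul]
  rfl

theorem leadExponent_inr (P : G.Walk u v) (i : Fin n) :
    leadExponent P (Sum.inrₗ i) =
      (if i ∈ joints P ∧ v < i then 1 else 0) + if u = i then 1 else 0 := by
  rw [leadExponent, Finsupp.add_apply, pathExponent_inr]
  simp [Finsupp.single_apply]

theorem leadExponent_inl (P : G.Walk u v) (i : Fin n) :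
    leadExponent P (Sum.inlₗ i) =
      (if i ∈ joints P ∧ i < u then 1 else 0) + if v = i then 1 else 0 := by
  rw [leadExponent, Finsupp.add_apply, pathExponent_inl]
  simp [Finsupp.single_apply]

theorem tailExponent_inr (P : G.Walk u v) (i : Fin n) :
    tailExponent P (Sum.inrₗ i) =
      (if i ∈ joints P ∧ v < i then 1 else 0) + if v = i then 1 else 0 := by
  rw [tailExponent, Finsupp.add_apply, pathExponent_inr]
  simp [Finsupp.single_apply]

theorem tailExponent_inl (P : G.Walk u v) (i : Fin n) :
    tailExponent P (Sum.inlₗ i) =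
      (if i ∈ joints P ∧ i < u then 1 else 0) + if u = i then 1 else 0 := by
  rw [tailExponent, Finsupp.add_apply, pathExponent_inl]
  simp [Finsupp.single_apply]

theorem tailExponent_lt (P : G.Walk u v) (huv : u < v) :
    (degRevLex (Var n)).toSyn (tailExponent P) < (degRevLex (Var n)).toSyn (leadExponent P) := by
  refine (degRevLex_lt_iff _ _).2 (Or.inr ⟨?_, Sum.inrₗ v, fun j hj => ?_, ?_⟩)
  · simp [tailExponent, leadExponent]
  · obtain ⟨j, rfl⟩ := toLex.surjective j
    rcases j with j | j
    · exact absurd hj (not_lt_of_gt (Sum.Lex.inl_lt_inr _ _))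
    · have hvj : v < j := Sum.Lex.inr_lt_inr_iff.1 hj
      refine (tailExponent_inr P j).trans (Eq.trans ?_ (leadExponent_inr P j).symm)
      rw [if_neg hvj.ne, if_neg (huv.trans hvj).ne]
  · rw [tailExponent_inr, leadExponent_inr]
    simp [huv.ne]

theorem degree_pathPoly (P : G.Walk u v) (huv : u < v) :
    (degRevLex (Var n)).degree (pathPoly K P) = leadExponent P := by
  classical
  rw [pathPoly_eq_monomial, MonomialOrder.degree_sub_of_lt, MonomialOrder.degree_monomial]
  · simp
  · simpa [MonomialOrder.degree_monomial] using tailExponent_lt P huv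

theorem leadingCoeff_pathPoly (P : G.Walk u v) (huv : u < v) :
    (degRevLex (Var n)).leadingCoeff (pathPoly K P) = 1 := by
  classical
  rw [pathPoly_eq_monomial, MonomialOrder.leadingCoeff_sub_of_lt,
    MonomialOrder.leadingCoeff_monomial]
  simpa [MonomialOrder.degree_monomial] using tailExponent_lt P huv

theorem leadingTerm_pathPoly (P : G.Walk u v) (huv : u < v) :
    (degRevLex (Var n)).leadingTerm (pathPoly K P) = monomial (leadExponent P) 1 := by
  rw [MonomialOrder.leadingTerm, degree_pathPoly P huv, leadingCoeff_pathPoly P huv]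

theorem leadExponent_le {P : G.Walk u v} (huv : u < v) {d : Var n →₀ ℕ} (hu : u ∈ xVerts d)
    (hv : v ∈ yVerts d) (hJ : ∀ p ∈ joints P, (p < u → p ∈ yVerts d) ∧ (v < p → p ∈ xVerts d)) :
    leadExponent P ≤ d := by
  intro i
  obtain ⟨i, rfl⟩ := toLex.surjective i
  rcases i with i | i
  · refine (leadExponent_inl P i).trans_le ?_
    change _ ≤ d (Sum.inlₗ i)
    have h1 : v = i → d (Sum.inlₗ i) ≠ 0 := by rintro rfl; exact hv
    have h2 : i ∈ joints P ∧ i < u → d (Sum.inlₗ i) ≠ 0 := fun h => (hJ i h.1).1 h.2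
    split_ifs <;> simp_all <;> omega
  · refine (leadExponent_inr P i).trans_le ?_
    change _ ≤ d (Sum.inrₗ i)
    have h1 : u = i → d (Sum.inrₗ i) ≠ 0 := by rintro rfl; exact hu
    have h2 : i ∈ joints P ∧ v < i → d (Sum.inrₗ i) ≠ 0 := fun h => (hJ i h.1).2 h.2
    split_ifs <;> simp_all <;> omega

/-! ### Membership of `g_P` in `I_G` -/

/-- If each vertex `p` is assigned one of `X_p` and `Y_p`, then the product of `[u, v]` with the
variables assigned to the joints of a path from `u` to `v` is in `I_G`. This follows by induction
on the path from the Plücker relations `X_w [u, v] = X_v [u, w] + X_u [w, v]` and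
`Y_w [u, v] = Y_v [u, w] + Y_u [w, v]`, where `w` is the second vertex. -/
theorem prod_mul_minor_mem (z : Fin n → MvPolynomial (Var n) K)
    (hz : ∀ p, z p = varX K p ∨ z p = varY K p) {u v : Fin n} (P : G.Walk u v) (hP : P.IsPath) :
    (∏ p ∈ joints P, z p) * minor K u v ∈ edgeIdeal K G := by
  induction P with
  | nil => simp [minor, mul_comm]
  | @cons u w v h P ih =>
    have hedge : minor K u w ∈ edgeIdeal K G := Ideal.subset_span ⟨u, w, h, rfl⟩
    rcases Nat.eq_zero_or_pos P.length with h0 | h0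
    · obtain rfl := SimpleGraph.Walk.eq_of_length_eq_zero h0
      exact Ideal.mul_mem_left _ _ hedge
    · have hPp := hP.of_cons
      have hw : w ∉ joints P := fun hw => (ne_ends_of_mem_joints hPp hw).1 rfl
      rw [joints_cons h P h0, Finset.prod_insert hw]
      have key : ∃ a b, z w * minor K u v = a * minor K u w + b * minor K w v := by
        rcases hz w with e | e
        · exact ⟨varX K v, varX K u, by rw [e, minor, minor, minor]; ring⟩
        · exact ⟨varY K v, varY K u, by rw [e, minor, minor, minor]; ring⟩
      obtain ⟨a, b, hab⟩ := key
      have : z w * (∏ p ∈ joints P, z p) * minor K u v =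
          (∏ p ∈ joints P, z p) * a * minor K u w +
            b * ((∏ p ∈ joints P, z p) * minor K w v) := by
        linear_combination (∏ p ∈ joints P, z p) * hab
      rw [this]
      exact add_mem (Ideal.mul_mem_left _ _ hedge) (Ideal.mul_mem_left _ _ (ih hPp))

theorem pathPoly_mem {P : G.Walk u v} (hP : IsIrreduciblePath P) :
    pathPoly K P ∈ edgeIdeal K G := by
  classical
  have hprod : pathMonomial K P = ∏ p ∈ joints P, if p < u then varY K p else varX K p := by
    rw [Finset.prod_ite, pathMonomial]
    congr 2
    ext p
    simp only [Finset.mem_filter, and_congr_right_iff, not_lt]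
    intro hp
    have hne := ne_ends_of_mem_joints hP.2.1 hp
    have hbetween := hP.2.2.2 p hp
    have := hP.1
    constructor
    · intro h
      exact (this.trans h).le
    · intro h
      exact lt_of_le_of_ne (not_lt.1 fun h' => hbetween ⟨lt_of_le_of_ne h hne.1.symm, h'⟩)
        hne.2.symm
  rw [pathPoly, hprod]
  exact prod_mul_minor_mem _ (fun p => by split_ifs <;> simp) P hP.2.1

/-! ### The Gröbner basis property -/

theorem finite_pathPolys (K : Type*) [Field K] (G : SimpleGraph (Fin n)) :
    {g | ∃ (u v : Fin n) (P : G.Walk u v), IsIrreduciblePath P ∧ g = pathPoly K P}.Finite := by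
  -- `g_P` only depends on the ends and the set of joints of `P`.
  refine (Set.finite_range fun t : Fin n × Fin n × Finset (Fin n) =>
    ((∏ p ∈ t.2.2 with p < t.1, varY K p) * ∏ p ∈ t.2.2 with t.2.1 < p, varX K p) *
      minor K t.1 t.2.1).subset ?_
  rintro _ ⟨u, v, P, -, rfl⟩
  exact ⟨(u, v, joints P), rfl⟩

theorem leadingTerm_mem_span {f : MvPolynomial (Var n) K} (hf : f ∈ edgeIdeal K G) :
    (degRevLex (Var n)).leadingTerm f ∈ Ideal.span ((degRevLex (Var n)).leadingTerm ''
      {g | ∃ (u v : Fin n) (P : G.Walk u v), IsIrreduciblePath P ∧ g = pathPoly K P}) := by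
  rcases eq_or_ne f 0 with rfl | h0
  · simp
  obtain ⟨e, hlt, hcls⟩ := exists_lt_monomialClass_eq hf h0
  obtain ⟨u, hu, v, hv, P, hP, hJ⟩ := exists_isIrreduciblePath (exists_linked_of_lt hlt hcls)
  refine Ideal.mem_of_dvd _ ?_ (Ideal.subset_span ⟨_, ⟨u, v, P, hP, rfl⟩, rfl⟩)
  rw [leadingTerm_pathPoly P hP.1, MonomialOrder.leadingTerm, monomial_dvd_monomial]
  exact ⟨Or.inr (leadExponent_le hP.1 hu hv hJ), one_dvd _⟩

/-- A monomial of `g_P` that is divisible by the leading monomial of `g_Q` is the leading monomial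
of `g_P`, and then `g_P = g_Q`. In `M_P X_u Y_v` the indices of the `X`-factors are `u` and joints
above `v`, those of the `Y`-factors `v` and joints below `u`; so `Q` has the same ends as `P`, and
all its joints are joints of `P`. In `M_P Y_u X_v` no `X`-factor has a smaller index than
a `Y`-factor. -/
theorem pathPoly_eq_of_leadExponent_le {P : G.Walk u v} (hP : IsIrreduciblePath P) {s t : Fin n}
    {Q : G.Walk s t} (hQ : IsIrreduciblePath Q)
    (h : leadExponent Q ≤ leadExponent P ∨ leadExponent Q ≤ tailExponent P) :
    pathPoly K P = pathPoly K Q := by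
  have huv := hP.1
  have hst := hQ.1
  have hsQ : 1 ≤ leadExponent Q (Sum.inrₗ s) := by rw [leadExponent_inr, if_pos rfl]; omega
  have htQ : 1 ≤ leadExponent Q (Sum.inlₗ t) := by rw [leadExponent_inl, if_pos rfl]; omega
  rcases h with h | h
  · have hs := hsQ.trans (h _)
    have ht := htQ.trans (h _)
    rw [leadExponent_inr] at hs
    rw [leadExponent_inl] at ht
    have hs' : u = s ∨ v < s := by
      by_contra! hc
      rw [if_neg hc.1, if_neg fun h' => absurd h'.2 (not_lt.2 hc.2)] at hs
      omega
    have ht' : v = t ∨ t < u := by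
      by_contra! hc
      rw [if_neg hc.1, if_neg fun h' => absurd h'.2 (not_lt.2 hc.2)] at ht
      omega
    obtain ⟨rfl, rfl⟩ : u = s ∧ v = t := by omega
    have hsub : joints Q ⊆ joints P := by
      intro p hp
      have hne := ne_ends_of_mem_joints hQ.2.1 hp
      by_contra hpP
      have hx := h (Sum.inrₗ p)
      have hy := h (Sum.inlₗ p)
      rw [leadExponent_inr, leadExponent_inr] at hx
      rw [leadExponent_inl, leadExponent_inl] at hy
      have hb := hQ.2.2.2 p hp
      simp only [hp, hpP, true_and, false_and, if_false, hne.1.symm, hne.2.symm] at hx hy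
      split_ifs at hx hy <;> omega
    have heq : joints P = joints Q := (hP.joints_subset Q hsub).antisymm hsub
    simp only [pathPoly, pathMonomial, heq]
  · exfalso
    have hs := hsQ.trans (h _)
    have ht := htQ.trans (h _)
    rw [tailExponent_inr] at hs
    rw [tailExponent_inl] at ht
    have hs' : v ≤ s := by
      by_contra! hc
      rw [if_neg (fun e : v = s => hc.ne e.symm), if_neg fun h' => absurd h'.2 hc.not_gt] at hs
      omega
    have ht' : t ≤ u := by
      by_contra! hc
      rw [if_neg hc.ne, if_neg fun h' => absurd h'.2 hc.not_gt] at ht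
      omega
    omega

end BinomialEdge

theorem theorem3p1 (K : Type*) [Field K] (n : ℕ) (G : SimpleGraph (Fin n)) :
    BinomialEdge.IsReducedGroebnerBasis
      (BinomialEdge.degRevLex (BinomialEdge.Var n)) (BinomialEdge.edgeIdeal K G)
      {g | ∃ (u v : Fin n) (P : G.Walk u v),
        BinomialEdge.IsIrreduciblePath P ∧ g = BinomialEdge.pathPoly K P} := by
  classical
  open BinomialEdge in
  have hsub : {g | ∃ (u v : Fin n) (P : G.Walk u v), IsIrreduciblePath P ∧ g = pathPoly K P} ⊆
      (edgeIdeal K G : Set (MvPolynomial (Var n) K)) := by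
    rintro _ ⟨u, v, P, hP, rfl⟩
    exact pathPoly_mem hP
  refine ⟨⟨BinomialEdge.finite_pathPolys K G, hsub,
    le_antisymm (Ideal.span_mono (Set.image_mono hsub)) (Ideal.span_le.2 ?_)⟩, ?_⟩
  · rintro _ ⟨f, hf, rfl⟩
    exact BinomialEdge.leadingTerm_mem_span hf
  · rintro _ ⟨u, v, P, hP, rfl⟩
    refine ⟨BinomialEdge.leadingCoeff_pathPoly P hP.1, fun d hd hmem => ?_⟩
    -- The ideal is generated by the monomials with the exponent vectors in `E`.
    let E : Set (BinomialEdge.Var n →₀ ℕ) := {a | ∃ (s t : Fin n) (Q : G.Walk s t),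
      BinomialEdge.IsIrreduciblePath Q ∧
        BinomialEdge.pathPoly K Q ≠ BinomialEdge.pathPoly K P ∧ a = BinomialEdge.leadExponent Q}
    have hE : Ideal.span ((BinomialEdge.degRevLex (BinomialEdge.Var n)).leadingTerm ''
        ({g | ∃ (u v : Fin n) (P : G.Walk u v),
          BinomialEdge.IsIrreduciblePath P ∧ g = BinomialEdge.pathPoly K P} \
            {BinomialEdge.pathPoly K P})) ≤
        Ideal.span ((fun a => MvPolynomial.monomial a (1 : K)) '' E) := by
      refine Ideal.span_mono ?_
      rintro _ ⟨_, ⟨⟨s, t, Q, hQ, rfl⟩, hne⟩, rfl⟩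
      exact ⟨_, ⟨s, t, Q, hQ, hne, rfl⟩, (BinomialEdge.leadingTerm_pathPoly Q hQ.1).symm⟩
    obtain ⟨_, ⟨s, t, Q, hQ, hne, rfl⟩, hle⟩ :=
      MvPolynomial.mem_ideal_span_monomial_image.1 (hE hmem) d
        (by simp [MvPolynomial.mem_support_iff])
    refine hne (BinomialEdge.pathPoly_eq_of_leadExponent_le hP hQ ?_).symm
    rw [BinomialEdge.pathPoly_eq_monomial] at hd
    rcases Finset.mem_union.1 (MvPolynomial.support_sub _ _ _ hd) with h | h
    · rw [Finset.mem_singleton.1 (MvPolynomial.support_monomial_subset h)] at hle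
      exact Or.inl hle
    · rw [Finset.mem_singleton.1 (MvPolynomial.support_monomial_subset h)] at hle
      exact Or.inr hle
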